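/- Let $\mathcal H$ be a finite-dimensional complex Hilbert space and let $H=H^\dagger$ be a Hamiltonian on $\mathcal H$ with an orthonormal basis of energy eigenvectors $|E_k\rangle$, $H|E_k\rangle=E_k|E_k\rangle$, whose energy gaps are non-degenerate: $E_k-E_l=E_m-E_n$ implies ($k=l$ and $m=n$) or ($k=m$ and $l=n$), where the indices run over all energy eigenvectors. Let $\mathcal H_R\subseteq\mathcal H$ be a non-zero subspace of dimension $d_R$ whose orthogonal projector $\Pi_R$ commutes with $H$, and let $B=B^\dagger$ be an observable on $\mathcal H$. Put $$\langle B\rangle_{\mathrm{mc}}=\operatorname{Tr}\Big[\tfrac{\Pi_R}{d_R}B\Big],\qquad \$[B]=\sum_k|E_k\rangle\langle E_k|\,B\,|E_k\rangle\langle E_k|,$$ and, for a unit vector $|\psi_0\rangle\in\mathcal H_R$, let $\psi_t=e^{-iHt}|\psi_0\rangle\langle\psi_0|e^{iHt}$. Then for every unit vector $|\psi_0\rangle\in\mathcal H_R$ the time average $$\langle\operatorname{Tr}[B\psi_t]\rangle_t=\lim_{\tau\to\infty}\frac1\tau\int_0^\tau\operatorname{Tr}[B\psi_t]\,dt$$ exists.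 If $|\psi_0\rangle$ is Haar-random, i.e. distributed according to the uniform (unitarily invariant) probability measure on the unit sphere of $\mathcal H_R$, then for every $\epsilon>0$ $$\mathbb P\big\{\,|\langle\operatorname{Tr}[B\psi_t]\rangle_t-\langle B\rangle_{\mathrm{mc}}|\ge\epsilon\,\big\}\;\le\;2\exp\!\Big(-\frac{C\,d_R\,\epsilon^2}{\|\$[B]\|_\infty^2}\Big),\qquad C=\frac1{36\pi^3},$$ where $\|\cdot\|_\infty$ is the operator norm; if $\$[B]=0$, the right-hand side is read as $0$, i.e. the probability is $0$. -/

import Mathlib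

open MeasureTheory Filter Topology

noncomputable section

namespace PureStateQSM

/-! ### Haar-random unit vectors -/

section Haar

variable (E : Type*) [NormedAddCommGroup E] [InnerProductSpace ℂ E] [FiniteDimensional ℂ E]
  [MeasurableSpace E] [BorelSpace E]

/-- The (unnormalized) surface measure on the unit sphere of a finite-dimensional complex Hilbert
space, regarded as a real Euclidean space of twice the dimension. -/
def surfaceMeasure : Measure (Metric.sphere (0 : E) 1) :=
  letI : InnerProductSpace ℝ E := InnerProductSpace.complexToReal
  (volume : Measure E).toSphere

/-- The distribution of a Haar-random state vector: the uniform probability measure on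
the unit sphere of `E`. -/
def haarState : Measure (Metric.sphere (0 : E) 1) :=
  (surfaceMeasure E Set.univ)⁻¹ • surfaceMeasure E

/-- The distribution of a Haar-random state vector is a probability measure. -/
theorem isProbabilityMeasure_haarState [Nontrivial E] : IsProbabilityMeasure (haarState E) := by
  let _ : InnerProductSpace ℝ E := InnerProductSpace.complexToReal
  refine ⟨?_⟩
  have h0 : surfaceMeasure E Set.univ ≠ 0 := by
    rw [Ne, Measure.measure_univ_eq_zero]
    exact (volume : Measure E).toSphere_ne_zero
  have h1 : surfaceMeasure E Set.univ ≠ ⊤ := by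
    have : IsFiniteMeasure (surfaceMeasure E) :=
      inferInstanceAs (IsFiniteMeasure (volume : Measure E).toSphere)
    exact measure_ne_top _ _
  simp only [haarState, Measure.smul_apply, smul_eq_mul]
  exact ENNReal.inv_mul_cancel h0 h1

variable {E}

/-- The action of a unitary operator on unit vectors. -/
def unitaryAct (U : E ≃ₗᵢ[ℂ] E) (ψ : Metric.sphere (0 : E) 1) : Metric.sphere (0 : E) 1 :=
  ⟨U ψ, by simp⟩

/-- The distribution of a Haar-random state vector is invariant under all unitaries. -/
theorem map_unitaryAct_haarState (U : E ≃ₗᵢ[ℂ] E) :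
    (haarState E).map (unitaryAct U) = haarState E := by
  let _ : InnerProductSpace ℝ E := InnerProductSpace.complexToReal
  have hm : Measurable (unitaryAct U) :=
    (U.continuous.measurable.comp measurable_subtype_coe).subtype_mk
  rw [haarState, Measure.map_smul]
  congr 1
  ext s hs
  rw [Measure.map_apply hm hs]
  change (volume : Measure E).toSphere _ = (volume : Measure E).toSphere _
  rw [Measure.toSphere_apply' _ (hm hs), Measure.toSphere_apply' _ hs]
  congr 1
  let V : E ≃ₗᵢ[ℝ] E :=
    { toLinearEquiv := U.toLinearEquiv.restrictScalars ℝ, norm_map' := U.norm_map }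
  refine Eq.trans ?_
    (V.measurePreserving.measure_preimage_emb V.toHomeomorph.measurableEmbedding _)
  congr 1
  ext x
  simp only [Set.mem_preimage, Set.mem_smul, Set.mem_image]
  constructor
  · rintro ⟨r, hr, _, ⟨y, hy, rfl⟩, rfl⟩
    exact ⟨r, hr, V y, ⟨unitaryAct U y, hy, rfl⟩, (map_smul V r (y : E)).symm⟩
  · rintro ⟨r, hr, _, ⟨y, hy, rfl⟩, hx⟩
    refine ⟨r, hr, U.symm y, ⟨unitaryAct U.symm y, ?_, rfl⟩, ?_⟩
    · have : unitaryAct U (unitaryAct U.symm y) = y := Subtype.ext (U.apply_symm_apply y)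
      rwa [this]
    · apply V.injective
      rw [← hx, map_smul]
      exact congrArg (r • ·) (U.apply_symm_apply (y : E))

end Haar

/-! ### Quantum mechanics on a finite-dimensional Hilbert space -/

section QM

variable {H : Type*} [NormedAddCommGroup H] [InnerProductSpace ℂ H] [FiniteDimensional ℂ H]

/-- The trace `Tr[A]` of an operator. -/
def Tr (A : H →L[ℂ] H) : ℂ := LinearMap.trace ℂ H (A : H →ₗ[ℂ] H)

/-- The pure density operator `|ψ⟩⟨ψ|` of a state vector `ψ`. -/
def pureState (ψ : H) : H →L[ℂ] H := InnerProductSpace.rankOne ℂ ψ ψ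

/-- The time evolution operator `U_t = exp(-i Ham t)` (units with `ħ = 1`). -/
def timeEvolution (Ham : H →L[ℂ] H) (t : ℝ) : H →L[ℂ] H :=
  NormedSpace.exp ((-Complex.I * (t : ℂ)) • Ham)

/-- The state `ρ_t = U_t ρ U_t†` at time `t` for the initial state `ρ`. -/
def evolve (Ham : H →L[ℂ] H) (t : ℝ) (ρ : H →L[ℂ] H) : H →L[ℂ] H :=
  timeEvolution Ham t * ρ * ContinuousLinearMap.adjoint (timeEvolution Ham t)

/-- The expectation value `Tr[B ψ_t]` of the observable `B` at time `t` for the initial state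
vector `ψ`. -/
def expectationAt (Ham B : H →L[ℂ] H) (ψ : H) (t : ℝ) : ℂ :=
  Tr (B * evolve Ham t (pureState ψ))

/-- The microcanonical expectation value `Tr[(Π_R / d_R) B]` with respect to the subspace `HR`,
where `Π_R` is the orthogonal projector onto `HR` and `d_R` is the dimension of `HR`. -/
def mcExpectation (HR : Submodule ℂ H) (B : H →L[ℂ] H) : ℂ :=
  Tr (((Module.finrank ℂ HR : ℂ)⁻¹ • HR.starProjection) * B)

/-- The dephasing map `A ↦ ∑ k, |e k⟩⟨e k| A |e k⟩⟨e k|` with respect to the orthonormal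
basis `e`. -/
def dephase {ι : Type*} [Fintype ι] (e : OrthonormalBasis ι ℂ H) (A : H →L[ℂ] H) : H →L[ℂ] H :=
  ∑ k, pureState (e k) * A * pureState (e k)

end QM

/-- Non-degenerate energy gaps of a family of energies, indexed by all energy eigenstates. -/
def NonDegenerateGaps {ι : Type*} (E : ι → ℝ) : Prop :=
  ∀ k l m n, E k - E l = E m - E n → (k = l ∧ m = n) ∨ (k = m ∧ l = n)

/-- The infinite-time average `lim_{τ → ∞} τ⁻¹ ∫₀^τ f(t) dt` exists and equals `a`. -/
def HasTimeAverage (f : ℝ → ℂ) (a : ℂ) : Prop :=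
  Tendsto (fun τ : ℝ => (τ : ℂ)⁻¹ * ∫ t in (0 : ℝ)..τ, f t) atTop (𝓝 a)

/-- The infinite-time average of `f` (meaningful when `HasTimeAverage f a` holds for some `a`). -/
def timeAverage (f : ℝ → ℂ) : ℂ :=
  limUnder atTop (fun τ : ℝ => (τ : ℂ)⁻¹ * ∫ t in (0 : ℝ)..τ, f t)

end PureStateQSM

end

namespace PureStateQSM

/-! ### Gaussian representation of Haar-random unit vectors -/

open scoped ENNReal

/-! Non-degenerate gaps force a simple spectrum, so time averaging kills every off-diagonal term and
leaves the quadratic form `∑ b_k |⟨e_k, ψ⟩|²` with `b_k = ⟨e_k, B e_k⟩`. Since `Π_R` commutes with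
the Hamiltonian, every `e_k` lies in `HR` or in its orthogonal complement. Those in `HR` form an
orthonormal basis of it, and the microcanonical value is the mean `m` of their `b_k`. As `|b_k| ≤ M
= ‖$[B]‖`, what remains is concentration of a quadratic form on the sphere around its mean.

Lévy's lemma is replaced by a Gaussian Chernoff bound. A Gaussian vector has a Haar-random
direction, so the Haar probability of the cone `∑ a_k |x_k|² ≥ 0` is a ratio of Gaussian integrals,
at most `∏ (1 - a_k)⁻¹` (`haarState_quadratic_nonneg_le`). Taking `a_k = l (b_k - m - ε)` and
optimizing `l` gives `exp (-d ε² / (64 M²))` (`haarState_quadratic_tail_le`), which suffices because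
`64 ≤ 36 π³`. -/

/-- Integration in polar coordinates of a radial function over a cone. -/
theorem setLIntegral_cone_eq_toSphere_mul {E : Type*} [NormedAddCommGroup E] [NormedSpace ℝ E]
    [FiniteDimensional ℝ E] [Nontrivial E] [MeasurableSpace E] [BorelSpace E] (μ : Measure E)
    [μ.IsAddHaarMeasure] {C : Set E} (hC : MeasurableSet C)
    (hcone : ∀ (r : ℝ) (x : E), 0 < r → (r • x ∈ C ↔ x ∈ C)) {f : ℝ → ℝ≥0∞} (hf : Measurable f) :
    ∫⁻ x in C, f ‖x‖ ∂μ = μ.toSphere {ψ | (ψ : E) ∈ C} *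
      ∫⁻ r : Set.Ioi (0 : ℝ), f r ∂(Measure.volumeIoiPow (Module.finrank ℝ E - 1)) := by
  have hS : MeasurableSet {ψ : Metric.sphere (0 : E) 1 | (ψ : E) ∈ C} := measurable_subtype_coe hC
  have hg : Measurable (C.indicator fun x : E => f ‖x‖) :=
    (hf.comp measurable_norm).indicator hC
  have h0 : MeasurableSet ({0}ᶜ : Set E) := (measurableSet_singleton 0).compl
  have h1 : ∫⁻ x in C, f ‖x‖ ∂μ =
      ∫⁻ x : ({0}ᶜ : Set E), C.indicator (fun x : E => f ‖x‖) x ∂(μ.comap Subtype.val) := by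
    rw [← lintegral_indicator hC, lintegral_subtype_comap h0, restrict_compl_singleton]
  rw [h1]
  have hmp := μ.measurePreserving_homeomorphUnitSphereProd.symm
    (homeomorphUnitSphereProd E).toMeasurableEquiv
  rw [← hmp.lintegral_comp (f := fun x : ({0}ᶜ : Set E) => C.indicator (fun x : E => f ‖x‖) x)
    (hg.comp measurable_subtype_coe)]
  -- In polar coordinates the cone sees only the direction and `f` only the radius, so the integrand
  -- is a product.
  have key : ∀ p : Metric.sphere (0 : E) 1 × Set.Ioi (0 : ℝ),
      C.indicator (fun x : E => f ‖x‖)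
        (((homeomorphUnitSphereProd E).toMeasurableEquiv.symm p : ({0}ᶜ : Set E)) : E)
      = {ψ : Metric.sphere (0 : E) 1 | (ψ : E) ∈ C}.indicator 1 p.1 * f p.2 := by
    rintro ⟨ψ, r, hr⟩
    have hr' : 0 < r := hr
    have e1 : (((homeomorphUnitSphereProd E).toMeasurableEquiv.symm (ψ, ⟨r, hr⟩) :
        ({0}ᶜ : Set E)) : E) = r • (ψ : E) := by
      simp [Homeomorph.toMeasurableEquiv_symm_coe]
    have e2 : ‖r • (ψ : E)‖ = r := by simp [norm_smul, abs_of_pos hr']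
    rw [e1]
    by_cases h : (ψ : E) ∈ C
    · rw [Set.indicator_of_mem ((hcone r ψ hr').2 h), Set.indicator_of_mem (by exact h), e2]
      simp
    · rw [Set.indicator_of_notMem (fun h' => h ((hcone r ψ hr').1 h')),
        Set.indicator_of_notMem (by exact h), zero_mul]
  simp only [key]
  rw [lintegral_prod_mul (f := {ψ : Metric.sphere (0 : E) 1 | (ψ : E) ∈ C}.indicator 1)
      (g := fun r : Set.Ioi (0 : ℝ) => f r)
      ((measurable_const.indicator hS).aemeasurable)
      (hf.comp measurable_subtype_coe).aemeasurable,
    lintegral_indicator_one hS]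

section

variable {E : Type*} [NormedAddCommGroup E] [InnerProductSpace ℂ E] [FiniteDimensional ℂ E]
  [MeasurableSpace E] [BorelSpace E]

/-- Under any radial density, direction and norm are independent: a cone receives its Haar
probability as its share of the total integral. Leaving `μ` existential keeps the auxiliary real
inner product out of the statement. -/
theorem exists_haarState_mul_lintegral_eq [Nontrivial E] : ∃ μ : Measure E, μ.IsAddHaarMeasure ∧
    ∀ C : Set E, MeasurableSet C → (∀ (r : ℝ) (x : E), 0 < r → (r • x ∈ C ↔ x ∈ C)) →
      ∀ f : ℝ → ℝ≥0∞, Measurable f →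
        haarState E {ψ | (ψ : E) ∈ C} * ∫⁻ x, f ‖x‖ ∂μ = ∫⁻ x in C, f ‖x‖ ∂μ := by
  let _ : InnerProductSpace ℝ E := InnerProductSpace.complexToReal
  have : FiniteDimensional ℝ E := FiniteDimensional.complexToReal E
  refine ⟨volume, inferInstance, fun C hC hcone f hf => ?_⟩
  have h1 := setLIntegral_cone_eq_toSphere_mul (volume : Measure E) hC hcone hf
  have h2 := setLIntegral_cone_eq_toSphere_mul (volume : Measure E) MeasurableSet.univ
    (by simp) hf
  have h0 : (volume : Measure E).toSphere Set.univ ≠ 0 := by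
    rw [Ne, Measure.measure_univ_eq_zero]
    exact (volume : Measure E).toSphere_ne_zero
  have ht : (volume : Measure E).toSphere Set.univ ≠ ∞ := measure_ne_top _ _
  rw [Measure.restrict_univ] at h2
  simp only [Set.mem_univ, Set.ofPred_true] at h2
  rw [h1, h2]
  change ((volume : Measure E).toSphere Set.univ)⁻¹ * (volume : Measure E).toSphere _ * _ = _
  rw [mul_comm _⁻¹, mul_assoc, ← mul_assoc _⁻¹, ENNReal.inv_mul_cancel h0 ht, one_mul]

theorem integrable_exp_neg_mul_norm_sq {b : ℝ} (hb : 0 < b) :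
    Integrable (fun z : ℂ => Real.exp (-(b * ‖z‖ ^ 2))) := by
  -- The Bochner integral of a non-integrable function is `0`, so a nonzero value proves
  -- integrability.
  apply Integrable.of_integral_ne_zero
  have := Complex.integral_exp_neg_mul_rpow (p := 2) (b := b) (by norm_num) hb
  simp only [Real.rpow_two, neg_mul] at this
  rw [this]
  have := Real.Gamma_pos_of_pos (s := 2 / 2 + 1) (by norm_num)
  have := Real.pi_pos
  positivity

theorem integral_exp_neg_mul_norm_sq {b : ℝ} (hb : 0 < b) :
    ∫ z : ℂ, Real.exp (-(b * ‖z‖ ^ 2)) = Real.pi * b⁻¹ := by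
  have := Complex.integral_exp_neg_mul_rpow (p := 2) (b := b) (by norm_num) hb
  simp only [Real.rpow_two, neg_mul] at this
  rw [this]
  norm_num [Real.Gamma_two, Real.rpow_neg_one]

theorem lintegral_pi_exp_neg_sum {σ : Type*} [Fintype σ] {a : σ → ℝ} (ha : ∀ k, 0 < a k) :
    ∫⁻ x : σ → ℂ, ENNReal.ofReal (Real.exp (-∑ k, a k * ‖x k‖ ^ 2)) =
      ENNReal.ofReal (∏ k, Real.pi * (a k)⁻¹) := by
  have h : ∀ x : σ → ℂ, Real.exp (-∑ k, a k * ‖x k‖ ^ 2) =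
      ∏ k, Real.exp (-(a k * ‖x k‖ ^ 2)) := fun x => by
    rw [← Finset.sum_neg_distrib, Real.exp_sum]
  simp only [h]
  rw [volume_pi, ← ofReal_integral_eq_lintegral_ofReal
      (Integrable.fintype_prod (f := fun k z => Real.exp (-(a k * ‖z‖ ^ 2)))
        (fun k => integrable_exp_neg_mul_norm_sq (ha k)))
      (ae_of_all _ fun x => Finset.prod_nonneg fun _ _ => (Real.exp_pos _).le)]
  congr 1
  refine (integral_fintype_prod_volume_eq_prod
    (fun (k : σ) (z : ℂ) => Real.exp (-(a k * ‖z‖ ^ 2)))).trans ?_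
  exact Finset.prod_congr rfl fun k _ => integral_exp_neg_mul_norm_sq (ha k)

/-- Gaussian integrals with respect to an arbitrary Haar measure on a complex Hilbert space. -/
theorem exists_lintegral_exp_neg_sum {σ : Type*} [Fintype σ] (e : OrthonormalBasis σ ℂ E)
    (μ : Measure E) [μ.IsAddHaarMeasure] : ∃ c : ℝ≥0∞, c ≠ 0 ∧ c ≠ ∞ ∧
      ∀ a : σ → ℝ, (∀ k, 0 < a k) →
        ∫⁻ x, ENNReal.ofReal (Real.exp (-∑ k, a k * ‖inner ℂ (e k) x‖ ^ 2)) ∂μ =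
          c * ENNReal.ofReal (∏ k, Real.pi * (a k)⁻¹) := by
  let L : E ≃L[ℝ] (σ → ℂ) :=
    (e.toBasis.equivFun.restrictScalars ℝ).toContinuousLinearEquivOfContinuous
      (LinearMap.continuous_of_finiteDimensional
        (e.toBasis.equivFun : E →ₗ[ℂ] (σ → ℂ)))
  have hL : ∀ x k, L x k = inner ℂ (e k) x := fun x k => e.repr_apply_apply x k
  have : (μ.map L).IsAddHaarMeasure := L.isAddHaarMeasure_map μ
  -- Uniqueness of Haar measure: the coordinate image of `μ` is a multiple of Lebesgue measure. The
  -- factor is independent of `a` and cancels in ratios.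
  have hc := Measure.isAddLeftInvariant_eq_smul (μ.map L) (volume : Measure (σ → ℂ))
  refine ⟨(μ.map L).addHaarScalarFactor volume, by
    simpa using (Measure.addHaarScalarFactor_pos_of_isAddHaarMeasure (μ.map L) volume).ne',
    ENNReal.coe_ne_top, fun a ha => ?_⟩
  rw [← lintegral_pi_exp_neg_sum ha, ← smul_eq_mul, ← ENNReal.smul_def, ← lintegral_smul_measure,
    ← hc, lintegral_map (by fun_prop) L.continuous.measurable]
  simp only [hL]

omit [FiniteDimensional ℂ E] in
theorem measurableSet_quadratic {σ : Type*} [Fintype σ] (e : σ → E) (a : σ → ℝ) :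
    MeasurableSet {x : E | 0 ≤ ∑ k, a k * ‖inner ℂ (e k) x‖ ^ 2} :=
  measurableSet_le measurable_const (Continuous.measurable (by fun_prop))

/-- A Chernoff bound for a quadratic form of a Haar-random unit vector. -/
theorem haarState_quadratic_nonneg_le [Nontrivial E] {σ : Type*} [Fintype σ]
    (e : OrthonormalBasis σ ℂ E) (a : σ → ℝ) (ha : ∀ k, a k < 1) :
    (haarState E).real {ψ | 0 ≤ ∑ k, a k * ‖inner ℂ (e k) (ψ : E)‖ ^ 2} ≤
      ∏ k, (1 - a k)⁻¹ := by
  obtain ⟨μ, hμ, hcone⟩ := exists_haarState_mul_lintegral_eq (E := E)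
  obtain ⟨c, hc0, hct, hc⟩ := exists_lintegral_exp_neg_sum e μ
  set C : Set E := {x : E | 0 ≤ ∑ k, a k * ‖inner ℂ (e k) x‖ ^ 2} with hC
  have h1 := hcone C (measurableSet_quadratic e a) (fun r x hr => by
    have : ∑ k, a k * ‖inner ℂ (e k) (r • x)‖ ^ 2 =
        r ^ 2 * ∑ k, a k * ‖inner ℂ (e k) x‖ ^ 2 := by
      rw [Finset.mul_sum]
      refine Finset.sum_congr rfl fun k _ => ?_
      rw [← Complex.coe_smul, inner_smul_right, norm_mul, mul_pow, Complex.norm_real,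
        Real.norm_eq_abs, sq_abs]
      ring
    simp only [hC, Set.mem_ofPred_eq, this]
    exact mul_nonneg_iff_of_pos_left (by positivity))
    (fun t => ENNReal.ofReal (Real.exp (-t ^ 2))) (by fun_prop)
  have hnorm : ∀ x : E, ‖x‖ ^ 2 = ∑ k, ‖inner ℂ (e k) x‖ ^ 2 := fun x =>
    (e.sum_sq_norm_inner_right x).symm
  have h2 : ∫⁻ x, ENNReal.ofReal (Real.exp (-‖x‖ ^ 2)) ∂μ =
      c * ENNReal.ofReal (∏ _k : σ, Real.pi) := by
    simpa only [one_mul, inv_one, mul_one, hnorm] using hc (fun _ => 1) (fun _ => one_pos)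
  -- Chernoff step: on `C` the factor `exp (∑ a_k |x_k|²)` is at least `1`; insert it, then
  -- integrate over the whole space, where `a_k < 1` ensures convergence.
  have h3 : ∫⁻ x in C, ENNReal.ofReal (Real.exp (-‖x‖ ^ 2)) ∂μ ≤
      c * ENNReal.ofReal (∏ k, Real.pi * (1 - a k)⁻¹) := by
    rw [← hc (fun k => 1 - a k) (fun k => sub_pos.2 (ha k))]
    refine (setLIntegral_mono' (measurableSet_quadratic e a) fun x hx => ?_).trans
      (setLIntegral_le_lintegral C _)
    refine ENNReal.ofReal_le_ofReal (Real.exp_le_exp.2 ?_)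
    have hx' : 0 ≤ ∑ k, a k * ‖inner ℂ (e k) x‖ ^ 2 := hx
    simp only [sub_mul, one_mul, Finset.sum_sub_distrib, ← hnorm]
    linarith
  rw [← h1, h2, Finset.prod_mul_distrib, mul_comm] at h3
  have hpi : 0 < ∏ _k : σ, Real.pi := Finset.prod_pos fun _ _ => Real.pi_pos
  rw [ENNReal.ofReal_mul hpi.le, ← mul_assoc] at h3
  have h4 := (ENNReal.mul_le_mul_iff_right (mul_ne_zero hc0 (ENNReal.ofReal_pos.2 hpi).ne')
    (ENNReal.mul_ne_top hct ENNReal.ofReal_ne_top)).1 h3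
  exact ENNReal.toReal_le_of_le_ofReal
    (Finset.prod_nonneg fun k _ => inv_nonneg.2 (sub_pos.2 (ha k)).le) h4

/-! ### Concentration of quadratic forms on the sphere. -/

theorem inv_one_sub_le_exp {x : ℝ} (h₁ : |x| ≤ 1 / 2) : (1 - x)⁻¹ ≤ Real.exp (x + x ^ 2) := by
  obtain ⟨h2, h3⟩ := abs_le.1 h₁
  have h4 : 0 < 1 - x := by linarith
  refine (inv_le_iff_one_le_mul₀ h4).2 ?_
  -- For `x < 0` the linear bound on `exp` suffices, as `(1 - x)(1 + x + x²) = 1 - x³ ≥ 1`; for `x ≥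
  -- 0` the quadratic Taylor term has to absorb `x³`.
  have h5 : 1 + (x + x ^ 2) + (x + x ^ 2) ^ 2 / 2 ≤ Real.exp (x + x ^ 2) ∨ x < 0 := by
    rcases lt_or_ge x 0 with h | h
    · exact Or.inr h
    · exact Or.inl (by
        have := Real.quadratic_le_exp_of_nonneg (x := x + x ^ 2) (by positivity)
        linarith)
  rcases h5 with h5 | h5
  · nlinarith [mul_le_mul_of_nonneg_right h5 h4.le, sq_nonneg x, sq_nonneg (x * (1 - x))]
  · nlinarith [mul_le_mul_of_nonneg_right (Real.add_one_le_exp (x + x ^ 2)) h4.le, sq_nonneg x]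

/-- One-sided concentration of the quadratic form with eigenvalues `b` around its mean. -/
theorem haarState_quadratic_tail_le [Nontrivial E] {σ : Type*} [Fintype σ]
    (e : OrthonormalBasis σ ℂ E) {b : σ → ℝ} {m M ε : ℝ} (hM : 0 < M) (hb : ∀ k, |b k| ≤ M)
    (hm : ∑ k, b k = Fintype.card σ * m) (hmM : |m| ≤ M) (hε : 0 < ε) (hεM : ε ≤ 2 * M) :
    (haarState E).real {ψ | ε ≤ ∑ k, b k * ‖inner ℂ (e k) (ψ : E)‖ ^ 2 - m} ≤
      Real.exp (-(Fintype.card σ * ε ^ 2 / (64 * M ^ 2))) := by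
  -- This `l` minimizes `-l ε + 16 M² l²`, the exponent per dimension obtained from `|b k - m - ε| ≤
  -- 4 M`.
  set l : ℝ := ε / (32 * M ^ 2) with hl
  have hl0 : 0 < l := by positivity
  have hlM : l * (16 * M) ≤ 1 := by
    rw [hl, div_mul_eq_mul_div, div_le_one (by positivity)]
    nlinarith
  have hx : ∀ k, |l * (b k - m - ε)| ≤ 1 / 2 := fun k => by
    have h1 : |b k - m - ε| ≤ 4 * M := by
      rw [abs_le] at *
      have := abs_le.1 (hb k)
      constructor <;> linarith [hmM.1, hmM.2, this.1, this.2]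
    rw [abs_mul, abs_of_pos hl0]
    nlinarith
  -- Since `∑ |ψ_k|² = 1`, the constant `m + ε` can be absorbed into the eigenvalues, making the
  -- event a cone.
  have hset : {ψ : Metric.sphere (0 : E) 1 |
      ε ≤ ∑ k, b k * ‖inner ℂ (e k) (ψ : E)‖ ^ 2 - m} =
      {ψ : Metric.sphere (0 : E) 1 | 0 ≤ ∑ k, (l * (b k - m - ε)) * ‖inner ℂ (e k) (ψ : E)‖ ^ 2} := by
    ext ψ
    have h1 : ∑ k, ‖inner ℂ (e k) (ψ : E)‖ ^ 2 = 1 := by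
      rw [e.sum_sq_norm_inner_right]; simp
    have h2 : ∑ k, (l * (b k - m - ε)) * ‖inner ℂ (e k) (ψ : E)‖ ^ 2 =
        l * (∑ k, b k * ‖inner ℂ (e k) (ψ : E)‖ ^ 2 - m - ε) := by
      simp only [mul_assoc, ← Finset.mul_sum, sub_mul, Finset.sum_sub_distrib, h1, mul_one]
    simp only [Set.mem_ofPred_eq, h2, mul_nonneg_iff_of_pos_left hl0, sub_nonneg]
  rw [hset]
  refine (haarState_quadratic_nonneg_le e _ fun k =>
    lt_of_le_of_lt (le_abs_self _) ((hx k).trans_lt (by norm_num))).trans ?_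
  refine (Finset.prod_le_prod (fun k _ => inv_nonneg.2 (by
    linarith [le_abs_self (l * (b k - m - ε)), hx k])) fun k _ =>
    inv_one_sub_le_exp (hx k)).trans ?_
  rw [← Real.exp_sum, Real.exp_le_exp, Finset.sum_add_distrib, ← Finset.mul_sum,
    Finset.sum_sub_distrib, Finset.sum_sub_distrib, hm]
  have h3 : ∀ k, (l * (b k - m - ε)) ^ 2 ≤ l ^ 2 * (16 * M ^ 2) := fun k => by
    have h1 : |b k - m - ε| ≤ 4 * M := by
      rw [abs_le] at *
      have := abs_le.1 (hb k)
      constructor <;> linarith [hmM.1, hmM.2, this.1, this.2]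
    rw [mul_pow]
    have := sq_le_sq.2 (h1.trans (le_abs_self _))
    nlinarith [sq_nonneg l]
  have h4 := Finset.sum_le_sum fun k (_ : k ∈ Finset.univ) => h3 k
  simp only [Finset.sum_const, Finset.card_univ, nsmul_eq_mul] at h4 ⊢
  have h5 : l ^ 2 * (16 * M ^ 2) = ε ^ 2 / (64 * M ^ 2) := by
    rw [hl]; field_simp; norm_num
  have h6 : l * ε = ε ^ 2 / (32 * M ^ 2) := by
    rw [hl]; ring
  have h7 : ε ^ 2 / (32 * M ^ 2) = 2 * (ε ^ 2 / (64 * M ^ 2)) := by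
    field_simp; norm_num
  rw [h5] at h4
  rw [mul_div_assoc]
  linear_combination h4 + (-(Fintype.card σ : ℝ)) * h6 - (Fintype.card σ : ℝ) * h7

end

/-! ### Time averages -/

theorem HasTimeAverage.sum {κ : Type*} (s : Finset κ) {f : κ → ℝ → ℂ} {a : κ → ℂ}
    (hf : ∀ k ∈ s, Continuous (f k)) (h : ∀ k ∈ s, HasTimeAverage (f k) (a k)) :
    HasTimeAverage (fun t => ∑ k ∈ s, f k t) (∑ k ∈ s, a k) := by
  have := tendsto_finsetSum s h
  refine this.congr fun τ => ?_
  rw [intervalIntegral.integral_finsetSum fun k hk => (hf k hk).intervalIntegrable _ _,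
    Finset.mul_sum]

theorem hasTimeAverage_const_mul_exp (c : ℂ) (w : ℝ) :
    HasTimeAverage (fun t : ℝ => c * Complex.exp (w * Complex.I * t)) (if w = 0 then c else 0) := by
  unfold HasTimeAverage
  split_ifs with hw
  · refine tendsto_const_nhds.congr' ?_
    filter_upwards [eventually_gt_atTop 0] with τ hτ
    have : (τ : ℂ) ≠ 0 := by exact_mod_cast hτ.ne'
    simp [hw, this]
  · have hw' : (w : ℂ) * Complex.I ≠ 0 := by simp [hw]
    -- At nonzero frequency the integral stays bounded by `‖c‖ * (2 / |w|)` uniformly in `τ`.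
    refine squeeze_zero_norm' (a := fun τ : ℝ => τ⁻¹ * (‖c‖ * (2 / |w|))) ?_ ?_
    · filter_upwards [eventually_gt_atTop 0] with τ hτ
      rw [intervalIntegral.integral_const_mul, integral_exp_mul_complex hw', norm_mul, norm_inv,
        Complex.norm_real, Real.norm_eq_abs, abs_of_pos hτ, norm_mul, norm_div]
      have h1 : ‖Complex.exp (w * Complex.I * τ)‖ = 1 := by
        rw [mul_right_comm, ← Complex.ofReal_mul, Complex.norm_exp_ofReal_mul_I]
      have h2 : ‖Complex.exp (w * Complex.I * τ) - Complex.exp (w * Complex.I * (0 : ℝ))‖ ≤ 2 := by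
        refine (norm_sub_le _ _).trans ?_
        rw [h1]
        norm_num
      have h3 : ‖(w : ℂ) * Complex.I‖ = |w| := by simp
      rw [h3]
      gcongr
    · simpa using tendsto_inv_atTop_zero.mul_const (‖c‖ * (2 / |w|))

/-! ### Unitary dynamics in the energy basis -/

section

variable {H : Type*} [NormedAddCommGroup H] [InnerProductSpace ℂ H] [FiniteDimensional ℂ H]

theorem exp_apply_of_apply_eq_smul {A : H →L[ℂ] H} {v : H} {c : ℂ} (h : A v = c • v) :
    NormedSpace.exp A v = Complex.exp c • v := by
  have : CompleteSpace H := FiniteDimensional.complete ℂ H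
  have hpow : ∀ n : ℕ, (A ^ n) v = c ^ n • v := fun n => by
    induction n with
    | zero => simp
    | succ n ih => rw [pow_succ', mul_apply_eq_comp, ih, map_smul, h, smul_smul, pow_succ]
  have h1 := (ContinuousLinearMap.apply ℂ H v).hasSum
    (NormedSpace.exp_series_hasSum_exp' (𝕂 := ℂ) A)
  have h2 := (NormedSpace.exp_series_hasSum_exp' (𝕂 := ℂ) c).smul_const v
  rw [Complex.exp_eq_exp_ℂ]
  refine h1.unique (h2.congr_fun ?_)
  intro n
  simp [hpow, smul_smul]

theorem expectationAt_eq_inner (Ham B : H →L[ℂ] H) (ψ : H) (t : ℝ) :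
    expectationAt Ham B ψ t =
      inner ℂ (timeEvolution Ham t ψ) (B (timeEvolution Ham t ψ)) := by
  set U := timeEvolution Ham t with hU
  have h : B * evolve Ham t (pureState ψ) = InnerProductSpace.rankOne ℂ (B (U ψ)) (U ψ) := by
    ext v
    simp [evolve, pureState, ← hU, ContinuousLinearMap.adjoint_inner_right]
  rw [expectationAt, Tr, h, InnerProductSpace.trace_rankOne]

variable {ι : Type*} [Fintype ι] {Ham : H →L[ℂ] H} {e : OrthonormalBasis ι ℂ H} {E : ι → ℝ}

theorem timeEvolution_apply_eq_sum (hE : ∀ k, Ham (e k) = (E k : ℂ) • e k) (ψ : H) (t : ℝ) :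
    timeEvolution Ham t ψ =
      ∑ k, (inner ℂ (e k) ψ * Complex.exp (-Complex.I * t * E k)) • e k := by
  have h : ∀ k, timeEvolution Ham t (e k) = Complex.exp (-Complex.I * t * E k) • e k := fun k =>
    exp_apply_of_apply_eq_smul (by rw [smul_apply, hE, smul_smul])
  conv_lhs => rw [← e.sum_repr' ψ]
  rw [map_sum]
  exact Finset.sum_congr rfl fun k _ => by rw [map_smul, h, smul_smul]

theorem expectationAt_eq_sum (hE : ∀ k, Ham (e k) = (E k : ℂ) • e k) (B : H →L[ℂ] H) (ψ : H)
    (t : ℝ) :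
    expectationAt Ham B ψ t = ∑ p : ι × ι,
      (starRingEnd ℂ (inner ℂ (e p.1) ψ) * inner ℂ (e p.2) ψ * inner ℂ (e p.1) (B (e p.2))) *
        Complex.exp ((E p.1 - E p.2 : ℝ) * Complex.I * t) := by
  rw [expectationAt_eq_inner, timeEvolution_apply_eq_sum hE, map_sum, sum_inner,
    Fintype.sum_prod_type]
  refine Finset.sum_congr rfl fun k _ => ?_
  rw [inner_sum]
  refine Finset.sum_congr rfl fun l _ => ?_
  have h : Complex.exp ((E k - E l : ℝ) * Complex.I * t) =
      starRingEnd ℂ (Complex.exp (-Complex.I * t * E k)) * Complex.exp (-Complex.I * t * E l) := by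
    rw [← Complex.exp_conj, ← Complex.exp_add]
    congr 1
    simp
    ring
  rw [map_smul, inner_smul_left, inner_smul_right, map_mul, h]
  ring

-- Two equal energies would make `E k - E l` coincide with the trivial gap `E k - E k`.
omit [Fintype ι] in
theorem NonDegenerateGaps.injective (h : NonDegenerateGaps E) : Function.Injective E :=
  fun k l hkl => by
    rcases h k l k k (by rw [hkl, sub_self]) with h | h
    · exact h.1
    · exact h.2.symm

theorem coe_re_inner_apply_self {B : H →L[ℂ] H} (hB : IsSelfAdjoint B) (x : H) :
    ((inner ℂ x (B x)).re : ℂ) = inner ℂ x (B x) := by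
  refine Complex.conj_eq_iff_re.1 ?_
  rw [inner_conj_symm]
  exact hB.isSymmetric x x

/-- The time average of an observable only sees its diagonal in a simple energy basis. -/
theorem hasTimeAverage_expectationAt (hE : ∀ k, Ham (e k) = (E k : ℂ) • e k)
    (hinj : Function.Injective E) {B : H →L[ℂ] H} (hB : IsSelfAdjoint B) (ψ : H) :
    HasTimeAverage (expectationAt Ham B ψ)
      ((∑ k, (inner ℂ (e k) (B (e k))).re * ‖inner ℂ (e k) ψ‖ ^ 2 : ℝ) : ℂ) := by
  classical
  have h := HasTimeAverage.sum (Finset.univ : Finset (ι × ι))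
    (f := fun p t => (starRingEnd ℂ (inner ℂ (e p.1) ψ) * inner ℂ (e p.2) ψ *
      inner ℂ (e p.1) (B (e p.2))) * Complex.exp ((E p.1 - E p.2 : ℝ) * Complex.I * t))
    (fun p _ => by fun_prop) (fun p _ => hasTimeAverage_const_mul_exp _ _)
  rw [funext (expectationAt_eq_sum hE B ψ)]
  convert h using 1
  rw [Fintype.sum_prod_type, Complex.ofReal_sum]
  refine Finset.sum_congr rfl fun k _ => ?_
  -- Only zero frequencies survive, and injectivity of `E` reduces them to the diagonal.
  simp only [sub_eq_zero, hinj.eq_iff, Finset.sum_ite_eq, Finset.mem_univ, if_true]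
  rw [Complex.ofReal_mul, coe_re_inner_apply_self hB, mul_comm, Complex.ofReal_pow,
    Complex.conj_mul']

/-! ### The restricted subspace and the dephased observable -/

/-- An operator commuting with `Ham` preserves its eigenspaces, which are lines here. -/
theorem starProjection_apply_eq_smul (hE : ∀ k, Ham (e k) = (E k : ℂ) • e k)
    (hinj : Function.Injective E) {P : H →L[ℂ] H} (hP : Commute P Ham) (hsa : IsSelfAdjoint Ham)
    (k : ι) : P (e k) = inner ℂ (e k) (P (e k)) • e k := by
  classical
  have h : ∀ j, j ≠ k → inner ℂ (e j) (P (e k)) = 0 := fun j hj => by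
    have h1 : Ham (P (e k)) = (E k : ℂ) • P (e k) := by
      rw [← map_smul, ← hE]
      exact (DFunLike.congr_fun hP.eq (e k)).symm
    have h2 : inner ℂ (Ham (e j)) (P (e k)) = inner ℂ (e j) (Ham (P (e k))) :=
      hsa.isSymmetric _ _
    rw [h1, hE, inner_smul_left, inner_smul_right, Complex.conj_ofReal] at h2
    have h3 : ((E j : ℂ) - E k) * inner ℂ (e j) (P (e k)) = 0 := by rw [sub_mul, h2, sub_self]
    refine (mul_eq_zero.1 h3).resolve_left fun h4 => hj (hinj ?_)
    exact_mod_cast sub_eq_zero.1 h4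
  conv_lhs => rw [← e.sum_repr' (P (e k))]
  exact Finset.sum_eq_single k (fun j _ hj => by rw [h j hj, zero_smul]) (by simp)

theorem mem_or_mem_orthogonal (hE : ∀ k, Ham (e k) = (E k : ℂ) • e k)
    (hinj : Function.Injective E) (hsa : IsSelfAdjoint Ham) {HR : Submodule ℂ H}
    (hcomm : Commute HR.starProjection Ham) (k : ι) : e k ∈ HR ∨ e k ∈ HRᗮ := by
  have h := starProjection_apply_eq_smul hE hinj hcomm hsa k
  by_cases h0 : inner ℂ (e k) (HR.starProjection (e k)) = 0
  · right
    rw [h0, zero_smul] at h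
    exact HR.starProjection_apply_eq_zero_iff.1 h
  · left
    have := HR.smul_mem (inner ℂ (e k) (HR.starProjection (e k)))⁻¹
      (h ▸ HR.starProjection_apply_mem (e k))
    rwa [smul_smul, inv_mul_cancel₀ h0, one_smul] at this

omit [FiniteDimensional ℂ H] in
/-- An orthonormal basis adapted to a subspace restricts to an orthonormal basis of it. -/
theorem exists_orthonormalBasis_subtype {HR : Submodule ℂ H} [Fintype {k // e k ∈ HR}]
    (h : ∀ k, e k ∈ HR ∨ e k ∈ HRᗮ) :
    ∃ b : OrthonormalBasis {k // e k ∈ HR} ℂ HR, ∀ k, (b k : H) = e k := by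
  let v : {k // e k ∈ HR} → HR := fun k => ⟨e k, k.2⟩
  have hv : Orthonormal ℂ v := by
    have h1 : Orthonormal ℂ (fun k : {k // e k ∈ HR} => e k) :=
      e.orthonormal.comp _ Subtype.val_injective
    exact (HR.subtypeₗᵢ.orthonormal_comp_iff (v := v)).1 h1
  refine ⟨OrthonormalBasis.mkOfOrthogonalEqBot hv ?_, fun k => by
    rw [OrthonormalBasis.coe_of_orthogonal_eq_bot_mk]⟩
  -- A vector of `HR` is already orthogonal to the `e k` in `HRᗮ`; if also orthogonal to the others,
  -- all its coefficients vanish.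
  refine (Submodule.eq_bot_iff _).2 fun y hy => Subtype.ext ?_
  rw [← e.sum_repr' (y : H)]
  refine Finset.sum_eq_zero fun k _ => ?_
  have h0 : inner ℂ (e k) (y : H) = 0 := by
    rcases h k with hk | hk
    · exact (Submodule.mem_orthogonal _ y).1 hy (v ⟨k, hk⟩) (Submodule.subset_span ⟨_, rfl⟩)
    · exact (HR.mem_orthogonal' (e k)).1 hk y y.2
  rw [h0, zero_smul]

theorem sum_eq_sum_subtype_of_eq_zero {M : Type*} [AddCommMonoid M] {p : ι → Prop}
    [Fintype {k // p k}] {f : ι → M} (hf : ∀ k, ¬ p k → f k = 0) :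
    ∑ k, f k = ∑ k : {k // p k}, f k := by
  classical
  rw [← Finset.sum_filter_of_ne (p := p) fun k _ hk => by_contra fun h => hk (hf k h)]
  exact Finset.sum_subtype _ (by simp) f

theorem mcExpectation_eq {HR : Submodule ℂ H} {B : H →L[ℂ] H} (hB : IsSelfAdjoint B)
    [Fintype {k // e k ∈ HR}] (h : ∀ k, e k ∈ HR ∨ e k ∈ HRᗮ) :
    mcExpectation HR B = (((Module.finrank ℂ HR : ℝ)⁻¹ *
      ∑ k : {k // e k ∈ HR}, (inner ℂ (e k) (B (e k))).re : ℝ) : ℂ) := by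
  have h1 : ∀ k, inner ℂ (e k) ((((Module.finrank ℂ HR : ℂ)⁻¹ • HR.starProjection) * B) (e k)) =
      (Module.finrank ℂ HR : ℂ)⁻¹ * inner ℂ (HR.starProjection (e k)) (B (e k)) := fun k => by
    rw [mul_apply_eq_comp, smul_apply, inner_smul_right, HR.inner_starProjection_left_eq_right]
  rw [mcExpectation, Tr, LinearMap.trace_eq_sum_inner _ e]
  simp only [ContinuousLinearMap.coe_coe, h1]
  rw [← Finset.mul_sum, sum_eq_sum_subtype_of_eq_zero (p := fun k => e k ∈ HR) fun k hk => by
    rw [HR.starProjection_apply_eq_zero_iff.2 ((h k).resolve_left hk), inner_zero_left]]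
  rw [Complex.ofReal_mul, Complex.ofReal_inv, Complex.ofReal_natCast, Complex.ofReal_sum]
  congr 1
  refine Finset.sum_congr rfl fun k _ => ?_
  rw [coe_re_inner_apply_self hB, HR.starProjection_eq_self_iff.2 k.2]

omit [FiniteDimensional ℂ H] in
theorem dephase_apply (B : H →L[ℂ] H) (k : ι) :
    dephase e B (e k) = inner ℂ (e k) (B (e k)) • e k := by
  rw [dephase, sum_apply, Finset.sum_eq_single k]
  · simp [pureState]
  · intro j _ hj
    simp [pureState, e.inner_eq_zero hj]
  · simp

-- The diagonal entries are the eigenvalues of the dephased operator, hence bounded by its norm;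
-- this supplies `M`.
omit [FiniteDimensional ℂ H] in
theorem abs_re_inner_le_norm_dephase (B : H →L[ℂ] H) (k : ι) :
    |(inner ℂ (e k) (B (e k))).re| ≤ ‖dephase e B‖ := by
  refine (Complex.abs_re_le_norm _).trans ?_
  have := (dephase e B).le_opNorm (e k)
  rwa [dephase_apply, norm_smul, e.norm_eq_one, mul_one, mul_one] at this

/-- The deviation of the time average from the microcanonical value is the deviation of a real
quadratic form from its mean. -/
theorem exists_norm_timeAverage_sub_mcExpectation_eq (hsa : IsSelfAdjoint Ham)
    (hE : ∀ k, Ham (e k) = (E k : ℂ) • e k) (hinj : Function.Injective E) {HR : Submodule ℂ H}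
    (hcomm : Commute HR.starProjection Ham) {B : H →L[ℂ] H} (hB : IsSelfAdjoint B) :
    ∃ (p : ι → Prop) (_ : Fintype {k // p k}) (b : OrthonormalBasis {k // p k} ℂ HR)
      (β : {k // p k} → ℝ), (∀ k, |β k| ≤ ‖dephase e B‖) ∧ ∀ ψ : HR,
        ‖timeAverage (expectationAt Ham B (ψ : H)) - mcExpectation HR B‖ =
          |∑ k, β k * ‖inner ℂ (b k) ψ‖ ^ 2 - (Module.finrank ℂ HR : ℝ)⁻¹ * ∑ k, β k| := by
  classical
  have hor := mem_or_mem_orthogonal hE hinj hsa hcomm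
  obtain ⟨b, hb⟩ := exists_orthonormalBasis_subtype hor
  refine ⟨fun k => e k ∈ HR, inferInstance, b, fun k => (inner ℂ (e k) (B (e k))).re,
    fun k => abs_re_inner_le_norm_dephase (e := e) B k.1, fun ψ => ?_⟩
  have h0 : ∀ k, e k ∉ HR → (inner ℂ (e k) (B (e k))).re * ‖inner ℂ (e k) (ψ : H)‖ ^ 2 = 0 :=
    fun k hk => by
      have h1 : inner ℂ (e k) (ψ : H) = 0 :=
        (HR.mem_orthogonal' (e k)).1 ((hor k).resolve_left hk) ψ ψ.2
      rw [h1, norm_zero, zero_pow two_ne_zero, mul_zero]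
  have h2 := (hasTimeAverage_expectationAt hE hinj hB (ψ : H)).limUnder_eq
  rw [timeAverage, h2, mcExpectation_eq hB hor, ← Complex.ofReal_sub, Complex.norm_real,
    Real.norm_eq_abs, sum_eq_sum_subtype_of_eq_zero h0]
  simp only [Submodule.coe_inner, hb]

end

/-- Two-sided concentration of the quadratic form with eigenvalues `b` around its mean. -/
theorem haarState_abs_quadratic_sub_mean_le {E : Type*} [NormedAddCommGroup E]
    [InnerProductSpace ℂ E] [FiniteDimensional ℂ E] [MeasurableSpace E] [BorelSpace E]
    [Nontrivial E] {σ : Type*} [Fintype σ] (e : OrthonormalBasis σ ℂ E) {b : σ → ℝ} {m M ε : ℝ}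
    (hM : 0 < M) (hb : ∀ k, |b k| ≤ M) (hm : ∑ k, b k = Fintype.card σ * m) (hε : 0 < ε) :
    (haarState E).real {ψ | ε ≤ |∑ k, b k * ‖inner ℂ (e k) (ψ : E)‖ ^ 2 - m|} ≤
      2 * Real.exp (-(Fintype.card σ * ε ^ 2 / (64 * M ^ 2))) := by
  have := isProbabilityMeasure_haarState E
  have hσ : Nonempty σ := e.toBasis.index_nonempty
  have hmM : |m| ≤ M := by
    have h1 : |∑ k, b k| ≤ Fintype.card σ * M := by
      refine (Finset.abs_sum_le_sum_abs _ _).trans ((Finset.sum_le_sum fun k _ => hb k).trans ?_)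
      simp
    rw [hm, abs_mul, Nat.abs_cast] at h1
    exact le_of_mul_le_mul_left h1 (by exact_mod_cast Fintype.card_pos)
  have hnorm : ∀ ψ : Metric.sphere (0 : E) 1, ∑ k, ‖inner ℂ (e k) (ψ : E)‖ ^ 2 = 1 := fun ψ => by
    rw [e.sum_sq_norm_inner_right]; simp
  have hbd : ∀ ψ : Metric.sphere (0 : E) 1,
      |∑ k, b k * ‖inner ℂ (e k) (ψ : E)‖ ^ 2| ≤ M := fun ψ => by
    refine (Finset.abs_sum_le_sum_abs _ _).trans ?_
    calc ∑ k, |b k * ‖inner ℂ (e k) (ψ : E)‖ ^ 2|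
        ≤ ∑ k, M * ‖inner ℂ (e k) (ψ : E)‖ ^ 2 := Finset.sum_le_sum fun k _ => by
          rw [abs_mul, abs_of_nonneg (sq_nonneg ‖inner ℂ (e k) (ψ : E)‖)]
          exact mul_le_mul_of_nonneg_right (hb k) (sq_nonneg _)
      _ = M := by rw [← Finset.mul_sum, hnorm, mul_one]
  rcases le_or_gt ε (2 * M) with hεM | hεM
  · have h1 := haarState_quadratic_tail_le e hM hb hm hmM hε hεM
    -- The lower tail is the upper tail of the negated form.
    have h2 := haarState_quadratic_tail_le e (b := fun k => -b k) (m := -m) hM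
      (fun k => by rw [abs_neg]; exact hb k)
      (by rw [Finset.sum_neg_distrib, hm, mul_neg]) (by rwa [abs_neg]) hε hεM
    refine (measureReal_mono (s₂ := {ψ : Metric.sphere (0 : E) 1 | ε ≤ ∑ k, b k * ‖inner ℂ (e k) (ψ : E)‖ ^ 2 - m} ∪
      {ψ | ε ≤ ∑ k, -b k * ‖inner ℂ (e k) (ψ : E)‖ ^ 2 - -m}) ?_).trans
      ((measureReal_union_le _ _).trans ((add_le_add h1 h2).trans_eq (two_mul _).symm))
    intro ψ hψ
    rcases le_abs.1 (show ε ≤ |_| from hψ) with h | h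
    · exact Or.inl h
    · refine Or.inr (h.trans_eq ?_)
      simp only [neg_mul, Finset.sum_neg_distrib]
      ring
  -- Both the form and its mean lie in `[-M, M]`, so a deviation above `2 * M` is impossible.
  · have : {ψ : Metric.sphere (0 : E) 1 |
        ε ≤ |∑ k, b k * ‖inner ℂ (e k) (ψ : E)‖ ^ 2 - m|} = ∅ := by
      refine Set.eq_empty_of_forall_notMem fun ψ hψ => ?_
      have h1 : ε ≤ |_ - m| := hψ
      have h2 := abs_sub (∑ k, b k * ‖inner ℂ (e k) (ψ : E)‖ ^ 2) m
      linarith [hbd ψ]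
    rw [this, measureReal_empty]
    positivity

end PureStateQSM

theorem mainTheorem5 {H : Type*} [NormedAddCommGroup H] [InnerProductSpace ℂ H]
    [FiniteDimensional ℂ H] [MeasurableSpace H] [BorelSpace H]
    {ι : Type*} [Fintype ι]
    (Ham : H →L[ℂ] H) (hHam : IsSelfAdjoint Ham)
    (e : OrthonormalBasis ι ℂ H) (E : ι → ℝ)
    (hE : ∀ k, Ham (e k) = (E k : ℂ) • e k)
    (hgaps : PureStateQSM.NonDegenerateGaps E)
    (HR : Submodule ℂ H) (hHR : HR ≠ ⊥) (hcomm : Commute HR.starProjection Ham)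
    (B : H →L[ℂ] H) (hB : IsSelfAdjoint B) :
    (∀ ψ : Metric.sphere (0 : HR) 1, ∃ a : ℂ,
      PureStateQSM.HasTimeAverage (PureStateQSM.expectationAt Ham B ((ψ : HR) : H)) a) ∧
    ∀ ε : ℝ, 0 < ε →
      (PureStateQSM.dephase e B ≠ 0 →
        (PureStateQSM.haarState HR).real {ψ : Metric.sphere (0 : HR) 1 |
          ε ≤ ‖PureStateQSM.timeAverage (PureStateQSM.expectationAt Ham B ((ψ : HR) : H))
            - PureStateQSM.mcExpectation HR B‖}
        ≤ 2 * Real.exp (-((36 * Real.pi ^ 3)⁻¹ * (Module.finrank ℂ HR : ℝ) * ε ^ 2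
            / ‖PureStateQSM.dephase e B‖ ^ 2))) ∧
      (PureStateQSM.dephase e B = 0 →
        (PureStateQSM.haarState HR).real {ψ : Metric.sphere (0 : HR) 1 |
          ε ≤ ‖PureStateQSM.timeAverage (PureStateQSM.expectationAt Ham B ((ψ : HR) : H))
            - PureStateQSM.mcExpectation HR B‖} = 0) := by
  have hinj := hgaps.injective
  refine ⟨fun ψ => ⟨_, PureStateQSM.hasTimeAverage_expectationAt hE hinj hB _⟩, fun ε hε => ?_⟩
  obtain ⟨p, hp, b, β, hβ, hdev⟩ := PureStateQSM.exists_norm_timeAverage_sub_mcExpectation_eq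
    hHam hE hinj hcomm hB
  have : Nontrivial HR := Submodule.nontrivial_iff_ne_bot.2 hHR
  have hcard : Module.finrank ℂ HR = Fintype.card {k // p k} :=
    Module.finrank_eq_card_basis b.toBasis
  have hd : (0 : ℝ) < Module.finrank ℂ HR := by exact_mod_cast Module.finrank_pos
  simp only [hdev]
  constructor
  · intro h0
    have hM : 0 < ‖PureStateQSM.dephase e B‖ := norm_pos_iff.2 h0
    refine (PureStateQSM.haarState_abs_quadratic_sub_mean_le b hM hβ
      (by rw [← hcard, mul_inv_cancel_left₀ hd.ne']) hε).trans ?_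
    rw [← hcard]
    refine mul_le_mul_of_nonneg_left (Real.exp_le_exp.2 (neg_le_neg ?_)) zero_le_two
    -- Already `π > 3` gives `36 π³ > 972`, leaving ample room.
    have hpi : (64 : ℝ) ≤ 36 * Real.pi ^ 3 := by
      have := pow_le_pow_left₀ (by norm_num) Real.pi_gt_three.le 3
      linarith
    calc (36 * Real.pi ^ 3)⁻¹ * (Module.finrank ℂ HR : ℝ) * ε ^ 2 / ‖PureStateQSM.dephase e B‖ ^ 2
        ≤ 64⁻¹ * (Module.finrank ℂ HR : ℝ) * ε ^ 2 / ‖PureStateQSM.dephase e B‖ ^ 2 := by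
          gcongr
      _ = _ := by field_simp
  · intro h0
    have hβ0 : ∀ k, β k = 0 := fun k => by simpa [h0] using hβ k
    simp [hβ0, hε.not_ge]
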